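/- **Model.** Let $m\ge 1$ be an integer and $\delta:\mathbb N\to(-m,\infty)$. The preferential attachment multigraphs $G_1,G_2,\dots$, where $G_t$ has vertices $v_0,\dots,v_t$, are built as follows. $G_1$ consists of $v_0$ and $v_1$ joined by $m$ edges. For $t>1$, $G_t$ is obtained from $G_{t-1}$ by adding a vertex $v_t$ and then, one after the other for $i=1,\dots,m$, an edge between $v_t$ and a random vertex $v_{t,i}\in\{v_0,\dots,v_{t-1}\}$ with $$\mathbb P(v_{t,i}=v\mid G_{t,i-1})=\frac{D_v(G_{t,i-1})+\delta(t)}{\sum_{j=0}^{t-1}\bigl(D_{v_j}(G_{t,i-1})+\delta(t)\bigr)},$$ where $G_{t,i-1}$ is the multigraph after the first $i-1$ of these edges have been added and $D_v(G)$ is the degree of $v$ in $G$, counted with multiplicity. Let $N_m(n)$ be the number of vertices of degree $m$ in $G_n$, and for $\delta>-m$ let $$p_m(\delta)=\frac{2+\delta/m}{m+\delta+2+\delta/m}.$$ **Proposition 7.1.** Let $m\ge1$, $\delta_0,\delta_1>-m$ with $\delta_0\ne\delta_1$, $c>0$ and $0<\gamma<1$ be fixed, and let $\tau_n$ be natural numbers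 with $\tau_n=n-cn^\gamma$ up to rounding, i.e. $|\tau_n-(n-cn^\gamma)|<1$ for all large $n$. For each $n$, let $\mathbb E_1$ denote expectation in the model with $\delta(t)=\delta_0$ for $t\le\tau_n$ and $\delta(t)=\delta_1$ for $t>\tau_n$. Then, as $n\to\infty$, $$\mathbb E_1[N_m(n)]-n\,p_m(\delta_0)=(1+o(1))\,c\,n^\gamma\left(1-\frac{p_m(\delta_0)}{p_m(\delta_1)}\right)=(1+o(1))\,c\,n^\gamma\,(\delta_0-\delta_1)\,\frac{1}{(2+\delta_1/m)(m+\delta_0+2+\delta_0/m)}.$$ -/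

import Mathlib

open Filter Asymptotics MeasureTheory

namespace PrefAttach

noncomputable section

/-- A finite undirected multigraph on vertices labelled by natural numbers (the vertex `v_i` is
the label `i`), given by its multiset of edges. The vertex set of the graph at time `t` is
`{0, …, t}`. -/
@[ext]
structure Multigraph where
  edges : Multiset (Sym2 ℕ)

/-- Every set of multigraphs is measurable. -/
instance : MeasurableSpace Multigraph := ⊤

namespace Multigraph

/-- The degree of `v`: the number of edges at `v`, counted with multiplicity (the graphs of the
model have no loops). -/
def degree (G : Multigraph) (v : ℕ) : ℕ := G.edges.countP (fun e => v ∈ e)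

/-- `G` with one more edge between `v` and `t`. -/
def addEdge (G : Multigraph) (v t : ℕ) : Multigraph := ⟨s(v, t) ::ₘ G.edges⟩

/-- The number of vertices of degree `k` among the vertices `0, …, t`. -/
def numDegree (k t : ℕ) (G : Multigraph) : ℕ :=
  ((Finset.range (t + 1)).filter (fun v => G.degree v = k)).card

/-- The sum of `D_u + d` over the vertices `u = 0, …, t - 1`. -/
def totalWeight (G : Multigraph) (d : ℝ) (t : ℕ) : ℝ :=
  ∑ u ∈ Finset.range t, ((G.degree u : ℝ) + d)

/-- The attachment probability of the vertex `v`. -/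
def attachProb (G : Multigraph) (d : ℝ) (t v : ℕ) : ℝ :=
  if v < t then ((G.degree v : ℝ) + d) / G.totalWeight d t else 0

theorem sum_attachProb (G : Multigraph) (d : ℝ) (t : ℕ)
    (h : 0 < t ∧ ∀ u < t, 0 < (G.degree u : ℝ) + d) :
    ∑ v ∈ Finset.range t, ENNReal.ofReal (G.attachProb d t v) = 1 := by
  have hpos : 0 < G.totalWeight d t :=
    Finset.sum_pos (fun u hu => h.2 u (Finset.mem_range.1 hu)) ⟨0, Finset.mem_range.2 h.1⟩
  rw [← ENNReal.ofReal_sum_of_nonneg, ← ENNReal.ofReal_one]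
  · congr 1
    have : ∀ v ∈ Finset.range t,
        G.attachProb d t v = ((G.degree v : ℝ) + d) / G.totalWeight d t := fun v hv => by
      simp [attachProb, Finset.mem_range.1 hv]
    rw [Finset.sum_congr rfl this, ← Finset.sum_div]
    exact div_self hpos.ne'
  · intro v hv
    have hv' := Finset.mem_range.1 hv
    simp only [attachProb, hv', if_true]
    exact div_nonneg (h.2 v hv').le hpos.le

open Classical in
/-- The random vertex in `{0, …, t - 1}` to which the next edge of the new vertex `t` is attached,
given the current graph `G`: it is `v` with probability
`(D_v(G) + d) / ∑_{u < t} (D_u(G) + d)`. The weights `D_u(G) + d` are positive for all graphs that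
occur in the model; the value `0` in the remaining case is a convention that plays no role. -/
def attachVertex (G : Multigraph) (d : ℝ) (t : ℕ) : PMF ℕ :=
  if h : 0 < t ∧ ∀ u < t, 0 < (G.degree u : ℝ) + d then
    PMF.ofFinset (fun v => ENNReal.ofReal (G.attachProb d t v)) (Finset.range t)
      (G.sum_attachProb d t h)
      (fun v hv => by simp [attachProb, Finset.mem_range.not.1 hv])
  else PMF.pure 0

/-- The law of the graph obtained from `G` by attaching `i` edges of the new vertex `t`, one after
the other, the degrees being updated after each edge. -/
def attachEdges (G : Multigraph) (d : ℝ) (t : ℕ) : ℕ → PMF Multigraph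
  | 0 => PMF.pure G
  | i + 1 => (attachEdges G d t i).bind
      (fun H => (H.attachVertex d t).map (fun v => H.addEdge v t))

end Multigraph

/-- The law of the preferential attachment graph `G_t` with `m` edges per vertex and
time-dependent attachment parameter `δ`. The seed `G_1` has the vertices `0, 1`, joined by `m`
edges; for `t > 1` the graph `G_t` arises from `G_{t-1}` by adding the vertex `t` and attaching its
`m` edges with parameter `δ t`. (Time `0` is not part of the model: by convention, no edges.) -/
def law (m : ℕ) (δ : ℕ → ℝ) : ℕ → PMF Multigraph
  | 0 => PMF.pure ⟨0⟩
  | 1 => PMF.pure ⟨Multiset.replicate m s(0, 1)⟩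
  | t + 2 => (law m δ (t + 1)).bind (fun G => G.attachEdges (δ (t + 2)) (t + 2) m)

/-- The attachment parameter with a changepoint: `δ₀` up to time `τ` and `δ₁` afterwards. -/
def changepoint (δ₀ δ₁ : ℝ) (τ t : ℕ) : ℝ := if t ≤ τ then δ₀ else δ₁

/-- The mean of `N_k(n)`, the number of vertices of degree `k` in `G_n`, in the model with
changepoint `τ`. -/
def meanNumDegree (m : ℕ) (δ₀ δ₁ : ℝ) (τ k n : ℕ) : ℝ :=
  ∫ G, (G.numDegree k n : ℝ) ∂(law m (changepoint δ₀ δ₁ τ) n).toMeasure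

/-- The limiting proportion `p_m(δ)` of vertices of minimal degree `m`. -/
def pMin (m : ℕ) (δ : ℝ) : ℝ := (2 + δ / m) / (m + δ + 2 + δ / m)

end

end PrefAttach

namespace PrefAttach

open scoped ENNReal

/-! The sum of the old degrees before each edge is deterministic, so an old vertex of degree `m` is
hit with a known probability. No old vertex enters degree `m`, and the new vertex always ends there.
Hence the mean `a` satisfies a closed recursion `a (t+1) = q (t+1) * a t + 1`
(`emean_law_numDegree`), with `q t = 1 - α / t + O(1 / t²)` and `p_m = 1 / (1 + α)`
(`survival_isBigO`, `pMin_eq`).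

Write `p₀`, `p₁` and `α₀`, `α₁` for these quantities at `δ₀`, `δ₁`. Up to `τ`, `a t = p₀ t + O(1)`,
since the recursion contracts errors (`exists_forall_abs_sub_le`). Afterwards `a t / t` is still
near `p₀`, so a step adds about `1 - p₀ α₁`, which exceeds `p₀` by `1 - p₀ (1 + α₁) = 1 - p₀ / p₁`.
Over `k = n - τ` steps the excess is `k (1 - p₀ / p₁)` up to `O(1 + k (1 + k) / τ)`
(`exists_forall_abs_sub_linear_le`). As `k ~ c n^γ` and `γ < 1`, this error is `o(n^γ)`. -/

/-- The mean of the `ℝ≥0∞`-valued function `f` under `p`. -/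
noncomputable def emean {α : Type*} (p : PMF α) (f : α → ℝ≥0∞) : ℝ≥0∞ := ∑' a, p a * f a

/-! ### Means as `ℝ≥0∞`-valued sums, where no summability is needed -/

section Mean

variable {α β : Type*}

theorem emean_pure (a : α) (f : α → ℝ≥0∞) : emean (PMF.pure a) f = f a := by
  unfold emean
  rw [tsum_eq_single a]
  · simp
  · intro b hb
    simp [PMF.pure_apply, hb]

theorem emean_bind (p : PMF α) (k : α → PMF β) (f : β → ℝ≥0∞) :
    emean (p.bind k) f = emean p (fun a => emean (k a) f) := by
  unfold emean
  simp only [PMF.bind_apply, ← ENNReal.tsum_mul_right, ← ENNReal.tsum_mul_left]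
  rw [ENNReal.tsum_comm]
  simp only [mul_assoc]

theorem emean_map (p : PMF α) (g : α → β) (f : β → ℝ≥0∞) :
    emean (p.map g) f = emean p (fun a => f (g a)) := by
  rw [PMF.map, emean_bind]
  simp [emean_pure]

theorem emean_congr {p : PMF α} {f g : α → ℝ≥0∞} (h : ∀ a ∈ p.support, f a = g a) :
    emean p f = emean p g := by
  unfold emean
  refine tsum_congr fun a => ?_
  by_cases ha : a ∈ p.support
  · rw [h a ha]
  · rw [(PMF.apply_eq_zero_iff p a).2 ha, zero_mul, zero_mul]

theorem emean_const_mul (p : PMF α) (c : ℝ≥0∞) (f : α → ℝ≥0∞) :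
    emean p (fun a => c * f a) = c * emean p f := by
  unfold emean
  rw [← ENNReal.tsum_mul_left]
  exact tsum_congr fun a => by ring

theorem emean_add_one (p : PMF α) (f : α → ℝ≥0∞) :
    emean p (fun a => f a + 1) = emean p f + 1 := by
  unfold emean
  simp only [mul_add, mul_one]
  rw [ENNReal.tsum_add, p.tsum_coe]

theorem integral_natCast_eq_toReal_emean [MeasurableSpace α] [DiscreteMeasurableSpace α]
    (p : PMF α) (f : α → ℕ) (B : ℕ) (hf : ∀ a, f a ≤ B) :
    ∫ a, (f a : ℝ) ∂p.toMeasure = (emean p (fun a => (f a : ℝ≥0∞))).toReal := by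
  rw [PMF.integral_eq_tsum]
  · unfold emean
    rw [ENNReal.tsum_toReal_eq]
    · simp
    · intro a
      exact ENNReal.mul_ne_top (p.apply_ne_top a) (ENNReal.natCast_ne_top _)
  · refine Integrable.of_bound (C := (B : ℝ))
      (Measurable.of_discrete).aestronglyMeasurable (Eventually.of_forall fun a => ?_)
    simpa using hf a

end Mean

/-! ### One round of attachments: deterministic weights and loss of degree-`m` vertices -/

namespace Multigraph

theorem degree_addEdge (G : Multigraph) (v t u : ℕ) :
    (G.addEdge v t).degree u = G.degree u + if u = v ∨ u = t then 1 else 0 := by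
  simp [addEdge, degree, Multiset.countP_cons]

/-- The number of vertices of degree `k` among `0, …, t - 1`. -/
def numOld (k t : ℕ) (G : Multigraph) : ℕ :=
  ((Finset.range t).filter (fun v => G.degree v = k)).card

/-- The degree conditions that hold after `i` edges of the vertex `t` have been attached. -/
structure IsStage (m t i : ℕ) (H : Multigraph) : Prop where
  le_degree : ∀ u < t, m ≤ H.degree u
  degree_new : H.degree t = i
  degree_later : ∀ u, t < u → H.degree u = 0
  sum_degree : ∑ u ∈ Finset.range t, H.degree u = 2 * m * (t - 1) + i

/-- The total weight of the vertices `0, …, t - 1` after `i` edges of the vertex `t` have been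
attached. -/
noncomputable def stageWeight (m : ℕ) (d : ℝ) (t i : ℕ) : ℝ := 2 * m * (t - 1) + i + t * d

namespace IsStage

variable {m t i : ℕ} {H : Multigraph} {d : ℝ}

theorem totalWeight_eq (h : IsStage m t i H) (ht : 0 < t) :
    H.totalWeight d t = stageWeight m d t i := by
  have h1 : ((∑ u ∈ Finset.range t, H.degree u : ℕ) : ℝ) = 2 * m * (t - 1) + i := by
    rw [h.sum_degree]
    push_cast [Nat.cast_sub (Nat.one_le_iff_ne_zero.2 ht.ne')]
    ring
  unfold totalWeight stageWeight
  rw [Finset.sum_add_distrib, ← Nat.cast_sum, h1]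
  simp

theorem weight_pos (h : IsStage m t i H) (hd : -(m : ℝ) < d) {u : ℕ} (hu : u < t) :
    0 < (H.degree u : ℝ) + d := by
  have : (m : ℝ) ≤ H.degree u := by exact_mod_cast h.le_degree u hu
  linarith

theorem attach_cond (h : IsStage m t i H) (ht : 0 < t) (hd : -(m : ℝ) < d) :
    0 < t ∧ ∀ u < t, 0 < (H.degree u : ℝ) + d := ⟨ht, fun _ hu => h.weight_pos hd hu⟩

theorem totalWeight_pos (h : IsStage m t i H) (ht : 0 < t) (hd : -(m : ℝ) < d) :
    0 < H.totalWeight d t :=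
  Finset.sum_pos (fun _ hu => h.weight_pos hd (Finset.mem_range.1 hu)) ⟨0, Finset.mem_range.2 ht⟩

theorem lt_of_mem_support (h : IsStage m t i H) (ht : 0 < t) (hd : -(m : ℝ) < d) {v : ℕ}
    (hv : v ∈ (H.attachVertex d t).support) : v < t := by
  rw [attachVertex, dif_pos (h.attach_cond ht hd), PMF.mem_support_ofFinset_iff] at hv
  exact Finset.mem_range.1 hv.1

theorem addEdge (h : IsStage m t i H) {v : ℕ} (hv : v < t) :
    IsStage m t (i + 1) (H.addEdge v t) where
  le_degree u hu := by
    rw [degree_addEdge]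
    exact (h.le_degree u hu).trans (Nat.le_add_right _ _)
  degree_new := by simp [degree_addEdge, h.degree_new]
  degree_later u hu := by
    rw [degree_addEdge, h.degree_later u hu, if_neg (by omega)]
  sum_degree := by
    simp only [degree_addEdge]
    rw [Finset.sum_add_distrib, h.sum_degree]
    have : ∑ u ∈ Finset.range t, (if u = v ∨ u = t then 1 else 0)
        = ∑ u ∈ Finset.range t, (if u = v then 1 else 0) := by
      refine Finset.sum_congr rfl fun u hu => ?_
      have := Finset.mem_range.1 hu
      simp [this.ne]
    rw [this, Finset.sum_ite_eq', if_pos (Finset.mem_range.2 hv)]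
    ring

theorem next (h : IsStage m t m H) (ht : 0 < t) : IsStage m (t + 1) 0 H where
  le_degree u hu := by
    rcases Nat.lt_succ_iff_lt_or_eq.1 hu with h' | rfl
    · exact h.le_degree u h'
    · exact h.degree_new.ge
  degree_new := h.degree_later _ (Nat.lt_succ_self t)
  degree_later u hu := h.degree_later u (by omega)
  sum_degree := by
    rw [Finset.sum_range_succ, h.sum_degree, h.degree_new]
    obtain ⟨s, rfl⟩ : ∃ s, t = s + 1 := ⟨t - 1, by omega⟩
    simp only [Nat.add_sub_cancel]
    ring

theorem attachEdges {G : Multigraph} (hG : IsStage m t 0 G) (ht : 0 < t) (hd : -(m : ℝ) < d)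
    (i : ℕ) : ∀ H ∈ (G.attachEdges d t i).support, IsStage m t i H := by
  induction i with
  | zero =>
    intro H hH
    rw [Multigraph.attachEdges, PMF.mem_support_pure_iff] at hH
    exact hH ▸ hG
  | succ i ih =>
    intro K hK
    rw [Multigraph.attachEdges, PMF.mem_support_bind_iff] at hK
    obtain ⟨H, hH, hK⟩ := hK
    rw [PMF.mem_support_map_iff] at hK
    obtain ⟨v, hv, rfl⟩ := hK
    exact (ih H hH).addEdge ((ih H hH).lt_of_mem_support ht hd hv)

/-- Old degrees are at least `m` and only grow, so an edge can take its endpoint out of degree `m`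
but bring no old vertex into it. -/
theorem numOld_addEdge (h : IsStage m t i H) {v : ℕ} (hv : v < t) :
    (H.addEdge v t).numOld m t + (if H.degree v = m then 1 else 0) = H.numOld m t := by
  unfold numOld
  have key : (Finset.range t).filter (fun u => (H.addEdge v t).degree u = m)
      = ((Finset.range t).filter (fun u => H.degree u = m)).erase v := by
    ext u
    simp only [Finset.mem_filter, Finset.mem_range, Finset.mem_erase, degree_addEdge]
    by_cases hut : u < t
    · have := h.le_degree u hut
      split_ifs with huv <;> omega
    · simp [hut]
  rw [key]
  split_ifs with hm
  · exact Finset.card_erase_add_one (by simp [hv, hm])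
  · rw [Finset.erase_eq_of_notMem (by simp [hm]), add_zero]

theorem le_stageWeight (h : IsStage m t i H) (ht : 0 < t) (hd : -(m : ℝ) < d) {v : ℕ}
    (hv : v < t) : (H.degree v : ℝ) + d ≤ stageWeight m d t i := by
  rw [← h.totalWeight_eq ht, totalWeight]
  exact Finset.single_le_sum (f := fun u => (H.degree u : ℝ) + d)
    (fun u hu => (h.weight_pos hd (Finset.mem_range.1 hu)).le) (Finset.mem_range.2 hv)

/-- All degree-`m` vertices have the same weight `m + d`, so the expected loss is proportional to
their number; the factor is deterministic because the total weight is. -/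
theorem emean_numOld (h : IsStage m t i H) (ht : 0 < t) (hd : -(m : ℝ) < d) :
    emean (H.attachVertex d t) (fun v => ((H.addEdge v t).numOld m t : ℝ≥0∞))
      = ENNReal.ofReal (1 - (m + d) / stageWeight m d t i) * (H.numOld m t : ℝ≥0∞) := by
  have hW := h.totalWeight_pos ht hd
  unfold emean
  rw [tsum_eq_sum (s := Finset.range t)]
  swap
  · intro v hv
    have : v ∉ (H.attachVertex d t).support := fun hv' =>
      hv (Finset.mem_range.2 (h.lt_of_mem_support ht hd hv'))
    rw [(PMF.apply_eq_zero_iff _ v).2 this, zero_mul]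
  have hprob : ∀ v ∈ Finset.range t, H.attachVertex d t v * ((H.addEdge v t).numOld m t : ℝ≥0∞)
      = ENNReal.ofReal (((H.degree v : ℝ) + d) / H.totalWeight d t
        * (H.numOld m t - if H.degree v = m then 1 else 0)) := by
    intro v hv
    have hv' := Finset.mem_range.1 hv
    have hN : ((H.addEdge v t).numOld m t : ℝ)
        = H.numOld m t - if H.degree v = m then 1 else 0 := by
      rw [← h.numOld_addEdge hv']
      push_cast
      ring
    rw [← hN, ENNReal.ofReal_mul (div_nonneg (h.weight_pos hd hv').le hW.le),
      ENNReal.ofReal_natCast, attachVertex, dif_pos (h.attach_cond ht hd), PMF.ofFinset_apply,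
      attachProb, if_pos hv']
  rw [Finset.sum_congr rfl hprob, ← ENNReal.ofReal_sum_of_nonneg, ← ENNReal.ofReal_natCast,
    ← ENNReal.ofReal_mul']
  · congr 1
    have hsum : ∑ v ∈ Finset.range t, ((H.degree v : ℝ) + d) / H.totalWeight d t = 1 := by
      rw [← Finset.sum_div]
      exact div_self hW.ne'
    have hmin : ∑ v ∈ Finset.range t, ((H.degree v : ℝ) + d) / H.totalWeight d t
        * (if H.degree v = m then 1 else 0) = (m + d) / H.totalWeight d t * H.numOld m t := by
      have : ∀ v ∈ Finset.range t, ((H.degree v : ℝ) + d) / H.totalWeight d t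
          * (if H.degree v = m then 1 else 0)
          = if H.degree v = m then (m + d) / H.totalWeight d t else 0 := by
        intro v _
        split_ifs with hm
        · rw [hm, mul_one]
        · rw [mul_zero]
      rw [Finset.sum_congr rfl this, ← Finset.sum_filter, Finset.sum_const, nsmul_eq_mul, mul_comm]
      rfl
    simp only [mul_sub]
    rw [Finset.sum_sub_distrib, ← Finset.sum_mul, hsum, hmin, h.totalWeight_eq ht]
    ring
  · exact Nat.cast_nonneg _
  · intro v hv
    have hv' := Finset.mem_range.1 hv
    refine mul_nonneg (div_nonneg (h.weight_pos hd hv').le hW.le) ?_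
    have := h.numOld_addEdge hv'
    rw [← this]
    push_cast
    simp

/-- The weight of vertex `0` is at least `m + d` and at most the total weight. -/
theorem one_sub_div_nonneg (h : IsStage m t i H) (ht : 0 < t) (hd : -(m : ℝ) < d) :
    0 ≤ 1 - (m + d) / stageWeight m d t i := by
  have h0 := h.le_stageWeight ht hd ht
  have h1 := h.totalWeight_pos ht hd
  rw [h.totalWeight_eq ht] at h1
  have h2 : (m : ℝ) ≤ H.degree 0 := by exact_mod_cast h.le_degree 0 ht
  rw [sub_nonneg, div_le_one h1]
  linarith

end IsStage

/-- The probability that an old vertex of degree `m` receives none of the `m` edges of the vertex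
`t`. -/
noncomputable def survival (m : ℕ) (d : ℝ) (t : ℕ) : ℝ :=
  ∏ i ∈ Finset.range m, (1 - (m + d) / stageWeight m d t i)

theorem emean_attachEdges_numOld {m t : ℕ} {d : ℝ} {G : Multigraph} (hG : IsStage m t 0 G)
    (ht : 0 < t) (hd : -(m : ℝ) < d) (k : ℕ) :
    emean (G.attachEdges d t k) (fun H => (H.numOld m t : ℝ≥0∞))
      = ENNReal.ofReal (∏ i ∈ Finset.range k, (1 - (m + d) / stageWeight m d t i))
        * (G.numOld m t : ℝ≥0∞) := by
  induction k with
  | zero => simp [attachEdges, emean_pure]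
  | succ k ih =>
    rw [attachEdges, emean_bind]
    have hstage := hG.attachEdges ht hd k
    obtain ⟨H₀, hH₀⟩ := (G.attachEdges d t k).support_nonempty
    rw [emean_congr (g := fun H => ENNReal.ofReal (1 - (m + d) / stageWeight m d t k)
      * (H.numOld m t : ℝ≥0∞)), emean_const_mul, ih, Finset.prod_range_succ, mul_comm (∏ _ ∈ _, _),
      ENNReal.ofReal_mul ((hstage H₀ hH₀).one_sub_div_nonneg ht hd), mul_assoc]
    intro H hH
    rw [emean_map, (hstage H hH).emean_numOld ht hd]

theorem survival_nonneg {m t : ℕ} {d : ℝ} {G : Multigraph} (hG : IsStage m t 0 G)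
    (ht : 0 < t) (hd : -(m : ℝ) < d) : 0 ≤ survival m d t := by
  refine Finset.prod_nonneg fun i _ => ?_
  obtain ⟨H, hH⟩ := (G.attachEdges d t i).support_nonempty
  exact (hG.attachEdges ht hd i H hH).one_sub_div_nonneg ht hd

theorem emean_attachEdges_numDegree {m t : ℕ} {d : ℝ} {G : Multigraph} (hG : IsStage m t 0 G)
    (ht : 0 < t) (hd : -(m : ℝ) < d) :
    emean (G.attachEdges d t m) (fun H => (H.numDegree m t : ℝ≥0∞))
      = ENNReal.ofReal (survival m d t) * (G.numOld m t : ℝ≥0∞) + 1 := by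
  rw [survival, ← emean_attachEdges_numOld hG ht hd, ← emean_add_one]
  refine emean_congr fun H hH => ?_
  have := (hG.attachEdges ht hd m H hH).degree_new
  rw [numDegree, Finset.range_add_one, Finset.filter_insert, if_pos this,
    Finset.card_insert_of_notMem (by simp)]
  push_cast
  rfl

end Multigraph

/-! ### The recursion for the mean -/

open Multigraph

theorem degree_seed (m u : ℕ) : (⟨Multiset.replicate m s(0, 1)⟩ : Multigraph).degree u
    = if u = 0 ∨ u = 1 then m else 0 := by
  unfold degree
  induction m with
  | zero => simp
  | succ m ih =>
    simp only [Multiset.replicate_succ, Multiset.countP_cons, ih, Sym2.mem_iff]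
    split_ifs <;> rfl

theorem isStage_law {m : ℕ} {δ : ℕ → ℝ} (hδ : ∀ t, -(m : ℝ) < δ t) (t : ℕ) :
    ∀ G ∈ (law m δ (t + 1)).support, IsStage m (t + 2) 0 G := by
  induction t with
  | zero =>
    intro G hG
    rw [law, PMF.mem_support_pure_iff] at hG
    subst hG
    constructor
    · intro u hu
      rw [degree_seed, if_pos (by omega)]
    · rw [degree_seed, if_neg (by omega)]
    · intro u hu
      rw [degree_seed, if_neg (by omega)]
    · simp [Finset.sum_range_succ, degree_seed]
      ring
  | succ t ih =>
    intro K hK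
    rw [law, PMF.mem_support_bind_iff] at hK
    obtain ⟨G, hG, hK⟩ := hK
    exact ((ih G hG).attachEdges (by omega) (hδ _) m K hK).next (by omega)

/-- The solution of the recursion for the mean number of vertices of degree `m`. -/
noncomputable def meanRec (m : ℕ) (δ : ℕ → ℝ) : ℕ → ℝ
  | 0 => 0
  | 1 => 2
  | t + 2 => survival m (δ (t + 2)) (t + 2) * meanRec m δ (t + 1) + 1

/-- Nonnegativity is read off from an actual graph; the model with constant parameter `d` supplies
one. -/
theorem survival_nonneg_of_lt {m : ℕ} {d : ℝ} (hd : -(m : ℝ) < d) (t : ℕ) :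
    0 ≤ survival m d (t + 2) := by
  obtain ⟨G, hG⟩ := (law m (fun _ => d) (t + 1)).support_nonempty
  exact survival_nonneg (isStage_law (fun _ => hd) t G hG) (by omega) hd

theorem meanRec_nonneg {m : ℕ} {δ : ℕ → ℝ} (hδ : ∀ t, -(m : ℝ) < δ t) (t : ℕ) :
    0 ≤ meanRec m δ t := by
  induction t using Nat.strong_induction_on with
  | _ t ih =>
    match t with
    | 0 => exact le_rfl
    | 1 => simp [meanRec]
    | t + 2 =>
      have := mul_nonneg (survival_nonneg_of_lt (hδ (t + 2)) t) (ih (t + 1) (by omega))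
      rw [meanRec]
      linarith

theorem emean_law_numDegree {m : ℕ} {δ : ℕ → ℝ} (hδ : ∀ t, -(m : ℝ) < δ t) (t : ℕ) :
    emean (law m δ (t + 1)) (fun G => (G.numDegree m (t + 1) : ℝ≥0∞))
      = ENNReal.ofReal (meanRec m δ (t + 1)) := by
  induction t with
  | zero =>
    rw [law, emean_pure]
    simp [numDegree, degree_seed, meanRec, Finset.range_add_one, Finset.filter_insert,
      Finset.filter_singleton]
  | succ t ih =>
    rw [law, emean_bind, emean_congr (g := fun G =>
      ENNReal.ofReal (survival m (δ (t + 2)) (t + 2)) * (G.numDegree m (t + 1) : ℝ≥0∞) + 1),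
      emean_add_one, emean_const_mul, ih, meanRec,
      ← ENNReal.ofReal_mul (survival_nonneg_of_lt (hδ _) t), ENNReal.ofReal_add _ zero_le_one,
      ENNReal.ofReal_one]
    · exact mul_nonneg (survival_nonneg_of_lt (hδ _) t) (meanRec_nonneg hδ _)
    · intro G hG
      exact emean_attachEdges_numDegree (isStage_law hδ t G hG) (by omega) (hδ _)

theorem meanNumDegree_eq_meanRec {m : ℕ} {δ₀ δ₁ : ℝ} (hδ₀ : -(m : ℝ) < δ₀)
    (hδ₁ : -(m : ℝ) < δ₁) (τ : ℕ) {n : ℕ} (hn : 1 ≤ n) :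
    meanNumDegree m δ₀ δ₁ τ m n = meanRec m (changepoint δ₀ δ₁ τ) n := by
  have hδ : ∀ t, -(m : ℝ) < changepoint δ₀ δ₁ τ t := by
    intro t
    unfold changepoint
    split_ifs <;> assumption
  obtain ⟨t, rfl⟩ : ∃ t, n = t + 1 := ⟨n - 1, by omega⟩
  rw [meanNumDegree, integral_natCast_eq_toReal_emean _ _ (t + 1 + 1), emean_law_numDegree hδ,
    ENNReal.toReal_ofReal (meanRec_nonneg hδ _)]
  intro G
  exact (Finset.card_filter_le _ _).trans (Finset.card_range _).le

/-! ### Expansion of the survival probability -/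

theorem div_sub_div_isBigO (A s b : ℝ) (hs : 0 < s) :
    (fun t : ℕ => A / (s * t + b) - A / s / t) =O[atTop] (fun t : ℕ => 1 / (t : ℝ) ^ 2) := by
  refine IsBigO.of_bound (2 * |A * b| / s ^ 2) ?_
  filter_upwards [eventually_gt_atTop 0,
    tendsto_natCast_atTop_atTop.eventually (eventually_ge_atTop (2 * |b| / s))] with t ht htb
  have ht' : (0 : ℝ) < t := by exact_mod_cast ht
  rw [div_le_iff₀ hs] at htb
  have hb := neg_abs_le b
  have hden : s * t / 2 ≤ s * t + b := by linarith
  have hst : 0 < s * t := mul_pos hs ht'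
  have hden' : 0 < s * t + b := by linarith
  have h1 : A / (s * t + b) - A / s / t = -(A * b) / ((s * t + b) * (s * t)) := by
    field_simp
    ring
  rw [h1, Real.norm_eq_abs, abs_div, abs_neg, abs_of_pos (mul_pos hden' hst), Real.norm_eq_abs,
    abs_of_pos (by positivity : 0 < 1 / (t : ℝ) ^ 2)]
  calc |A * b| / ((s * t + b) * (s * t)) ≤ |A * b| / (s * t / 2 * (s * t)) := by gcongr
    _ = 2 * |A * b| / s ^ 2 * (1 / (t : ℝ) ^ 2) := by
      field_simp

theorem prod_one_sub_isBigO {β : ℝ} {x : ℕ → ℕ → ℝ}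
    (hx : ∀ i, (fun t : ℕ => x i t - β / t) =O[atTop] (fun t : ℕ => 1 / (t : ℝ) ^ 2)) (k : ℕ) :
    (fun t : ℕ => (∏ i ∈ Finset.range k, (1 - x i t)) - (1 - k * β / t))
      =O[atTop] (fun t : ℕ => 1 / (t : ℝ) ^ 2) := by
  have hinv : ∀ c : ℝ, Tendsto (fun t : ℕ => c / (t : ℝ)) atTop (nhds 0) :=
    fun c => tendsto_const_div_atTop_nhds_zero_nat c
  have hinv2 : Tendsto (fun t : ℕ => 1 / (t : ℝ) ^ 2) atTop (nhds 0) := by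
    exact (tendsto_const_div_pow (1 : ℝ) 2 two_ne_zero).comp tendsto_natCast_atTop_atTop
  induction k with
  | zero => simpa using isBigO_zero _ _
  | succ k ih =>
    have hx0 : (fun t : ℕ => 1 - x k t) =O[atTop] (fun _ => (1 : ℝ)) := by
      have h1 := ((hx k).trans_tendsto hinv2).add (hinv β)
      simp only [sub_add_cancel, add_zero] at h1
      exact (h1.const_sub 1).isBigO_one ℝ
    have hk0 : (fun t : ℕ => 1 - k * β / t) =O[atTop] (fun _ => (1 : ℝ)) :=
      ((hinv (k * β)).const_sub 1).isBigO_one ℝ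
    have e1 := ih.mul hx0
    have e2 := hk0.mul (hx k)
    -- The cross term of `(1 - kβ/t)(1 - β/t)`.
    have e3 : (fun t : ℕ => k * β ^ 2 * (1 / (t : ℝ) ^ 2)) =O[atTop]
        (fun t : ℕ => 1 / (t : ℝ) ^ 2) := isBigO_const_mul_self _ _ _
    simp only [mul_one, one_mul] at e1 e2
    refine ((e1.sub e2).add e3).congr_left fun t => ?_
    rw [Finset.prod_range_succ]
    push_cast
    ring

/-- The rate `α` with `p_m = 1 / (1 + α)`. -/
noncomputable def hitRate (m : ℕ) (d : ℝ) : ℝ := m * ((m + d) / (2 * m + d))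

/-- The weight is `(2m + d) t + (i - 2m)`, so the edge index `i` affects only the second order. -/
theorem survival_isBigO {m : ℕ} {d : ℝ} (hd : -(m : ℝ) < d) :
    (fun t : ℕ => Multigraph.survival m d t - (1 - hitRate m d / t))
      =O[atTop] (fun t : ℕ => 1 / (t : ℝ) ^ 2) := by
  have hm : (0 : ℝ) ≤ m := Nat.cast_nonneg m
  refine prod_one_sub_isBigO (x := fun i t => (m + d) / Multigraph.stageWeight m d t i)
    (fun i => ?_) m
  refine (div_sub_div_isBigO (m + d) (2 * m + d) (i - 2 * m) (by linarith)).congr_left fun t => ?_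
  rw [Multigraph.stageWeight]
  congr 2
  ring

theorem exists_survival_bound {m : ℕ} {d : ℝ} (hd : -(m : ℝ) < d) :
    ∃ C T, 0 ≤ C ∧ ∀ t : ℕ, T ≤ t →
      |Multigraph.survival m d t - (1 - hitRate m d / t)| ≤ C / (t : ℝ) ^ 2 := by
  obtain ⟨C, hC, h⟩ := (survival_isBigO hd).exists_nonneg
  obtain ⟨T, hT⟩ := eventually_atTop.1 h.bound
  refine ⟨C, T, hC, fun t ht => ?_⟩
  have := hT t ht
  rwa [Real.norm_eq_abs, Real.norm_of_nonneg (by positivity), mul_one_div] at this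

theorem hitRate_pos {m : ℕ} (hm : 1 ≤ m) {d : ℝ} (hd : -(m : ℝ) < d) : 0 < hitRate m d := by
  have hm' : (0 : ℝ) < m := by exact_mod_cast hm
  exact mul_pos hm' (div_pos (by linarith) (by linarith))

theorem pMin_eq {m : ℕ} (hm : 1 ≤ m) {d : ℝ} (hd : -(m : ℝ) < d) :
    pMin m d = 1 / (1 + hitRate m d) := by
  have hm' : (0 : ℝ) < m := by exact_mod_cast hm
  have h1 : 0 < 2 * m + d := by linarith
  have h2 : 0 < m + d := by linarith
  have h3 : 2 + d / m = (2 * m + d) / m := by field_simp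
  have h4 : m + d + 2 + d / m = (m * (m + d) + (2 * m + d)) / m := by
    field_simp
    ring
  have h5 : 1 + hitRate m d = (m * (m + d) + (2 * m + d)) / (2 * m + d) := by
    rw [hitRate, eq_div_iff h1.ne', add_mul, mul_assoc, div_mul_cancel₀ _ h1.ne']
    ring
  have h6 : 0 < m * (m + d) + (2 * m + d) := by positivity
  rw [pMin, h3, h4, h5]
  field_simp

/-! ### The perturbed linear recursion -/

section Recursion

variable {q : ℕ → ℝ} {α C : ℝ} {T : ℕ}

/-- For `p = 1 / (1 + α)` the constant terms cancel, and `a t - p t` is multiplied by at most `1 - α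
/ (2(t+1))` while gaining `O(1 / (t+1))`. -/
theorem exists_forall_abs_sub_le (hα : 0 < α)
    (hq : ∀ t : ℕ, T ≤ t → |q t - (1 - α / t)| ≤ C / (t : ℝ) ^ 2) {a : ℕ → ℝ}
    (ha : ∀ t, T ≤ t → a (t + 1) = q (t + 1) * a t + 1) :
    ∃ K T', 0 ≤ K ∧ ∀ t : ℕ, T' ≤ t → |a t - 1 / (1 + α) * t| ≤ K := by
  set p := 1 / (1 + α) with hp
  have hp0 : 0 < p := by positivity
  have hpα : p * α = 1 - p := by
    rw [hp]
    field_simp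
    ring
  obtain ⟨T₁, hT₁⟩ := exists_nat_ge (max α (2 * C / α))
  set T' := max T T₁ with hT'
  -- The second entry makes the contraction `K α / 2` absorb the forcing `p α + p C`.
  set K := max |a T' - p * T'| (2 * (p * α + p * C) / α) with hK
  have hKα : 2 * (p * α + p * C) / α ≤ K := le_max_right _ _
  rw [div_le_iff₀ hα] at hKα
  have hK0 : 0 ≤ K := (abs_nonneg _).trans (le_max_left _ _)
  refine ⟨K, T', hK0, fun t ht => ?_⟩
  induction t, ht using Nat.le_induction with
  | base => exact le_max_left _ _
  | succ t ht ih =>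
    have hs0 : (0 : ℝ) < (t : ℝ) + 1 := by positivity
    have hT₁t : (T₁ : ℝ) ≤ t := by exact_mod_cast (le_max_right _ _).trans ht
    have hαs : α ≤ (t : ℝ) + 1 := by linarith [le_max_left α (2 * C / α)]
    have hCs : 2 * C / α ≤ (t : ℝ) + 1 := by linarith [le_max_right α (2 * C / α)]
    rw [div_le_iff₀ hα] at hCs
    have hqs := hq (t + 1) (((le_max_left _ _).trans ht).trans (Nat.le_succ t))
    push_cast at hqs ⊢
    rw [ha t ((le_max_left _ _).trans ht)]
    set r := q (t + 1) - (1 - α / ((t : ℝ) + 1)) with hr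
    have hqr : q (t + 1) = 1 - α / ((t : ℝ) + 1) + r := by rw [hr]; ring
    have hCle : C / ((t : ℝ) + 1) ^ 2 ≤ α / 2 / (t + 1) := by
      rw [div_le_div_iff₀ (by positivity) hs0]
      nlinarith
    have hα1 : α / ((t : ℝ) + 1) ≤ 1 := (div_le_one hs0).2 hαs
    have hrabs := abs_le.1 hqs
    have hqabs : |q (t + 1)| ≤ 1 - α / 2 / ((t : ℝ) + 1) := by
      have : α / ((t : ℝ) + 1) = α / 2 / (t + 1) + α / 2 / (t + 1) := by ring
      rw [hqr, abs_le]
      constructor <;> linarith [hrabs.1, hrabs.2]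
    have hsplit : q (t + 1) * a t + 1 - p * ((t : ℝ) + 1)
        = q (t + 1) * (a t - p * t) + (p * α / (t + 1) + p * t * r) := by
      rw [hqr]
      field_simp
      linear_combination (-((t : ℝ) + 1)) * hpα
    have hres : |p * α / ((t : ℝ) + 1) + p * t * r| ≤ (p * α + p * C) / (t + 1) := by
      have h1 : |p * t * r| ≤ p * C / (t + 1) := by
        rw [abs_mul, abs_of_nonneg (by positivity : 0 ≤ p * (t : ℝ))]
        calc p * t * |r| ≤ p * (t + 1) * (C / ((t : ℝ) + 1) ^ 2) := by
              gcongr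
              linarith
          _ = p * C / (t + 1) := by field_simp
      calc _ ≤ |p * α / ((t : ℝ) + 1)| + |p * t * r| := abs_add_le _ _
        _ ≤ p * α / (t + 1) + p * C / (t + 1) := by
          rw [abs_of_pos (by positivity : 0 < p * α / ((t : ℝ) + 1))]
          gcongr
        _ = _ := by ring
    rw [hsplit]
    calc _ ≤ |q (t + 1)| * |a t - p * t| + |p * α / ((t : ℝ) + 1) + p * t * r| := by
          rw [← abs_mul]
          exact abs_add_le _ _
      _ ≤ (1 - α / 2 / ((t : ℝ) + 1)) * K + (p * α + p * C) / (t + 1) := by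
          refine add_le_add (mul_le_mul hqabs ih (abs_nonneg _) ?_) hres
          exact (abs_nonneg _).trans hqabs
      _ ≤ K := by
          have : (p * α + p * C) / (t + 1) ≤ (K * α / 2) / ((t : ℝ) + 1) := by
            gcongr
            linarith
          have h2 : α / 2 / ((t : ℝ) + 1) * K = (K * α / 2) / ((t : ℝ) + 1) := by ring
          linarith

/-- Here `p` need not be the equilibrium slope, so a linear drift appears. The constants are uniform
in `τ` and `b`, as the sequence changes with the changepoint. -/
theorem exists_forall_abs_sub_linear_le (hα : 0 < α) (hC : 0 ≤ C)
    (hq : ∀ t : ℕ, T ≤ t → |q t - (1 - α / t)| ≤ C / (t : ℝ) ^ 2) (p : ℝ) {K : ℝ} (hK : 0 ≤ K) :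
    ∃ C' T', 0 ≤ C' ∧ ∀ τ : ℕ, T' ≤ τ → ∀ b : ℕ → ℝ,
      (∀ t, τ ≤ t → b (t + 1) = q (t + 1) * b t + 1) → |b τ - p * τ| ≤ K →
      ∀ k : ℕ, |b (τ + k) - p * (τ + k) - (1 - p * α - p) * k| ≤ K + C' * (k * (1 + k) / τ) := by
  obtain ⟨T₁, hT₁⟩ := exists_nat_ge (max α (C / α))
  set M := 1 + |p| + 2 * |p| * (α + C) with hM
  have hM0 : 0 ≤ M := by positivity
  set C' := (α + C) * (K + M) + |p| * (α + 2 * C) with hC'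
  have hC'0 : 0 ≤ C' := by positivity
  refine ⟨C', max (max T T₁) 1, hC'0, fun τ hτ b hb hbτ => ?_⟩
  have hτ0 : (0 : ℝ) < τ := by exact_mod_cast (le_max_right _ _).trans hτ
  have hw : ∀ t : ℕ, τ ≤ t → |q (t + 1)| ≤ 1 ∧ |1 - q (t + 1)| ≤ (α + C) / (t + 1) ∧
      |(1 - q (t + 1)) * t - α| ≤ (α + 2 * C) / (t + 1) := by
    intro t ht
    have hs0 : (0 : ℝ) < (t : ℝ) + 1 := by positivity
    have hs1 : (1 : ℝ) ≤ (t : ℝ) + 1 := by linarith [(Nat.cast_nonneg t : (0 : ℝ) ≤ t)]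
    have hTt := hτ.trans ht
    have hT₁t : (T₁ : ℝ) ≤ t := by
      exact_mod_cast (le_max_right T T₁).trans ((le_max_left _ _).trans hTt)
    have hαs : α ≤ (t : ℝ) + 1 := by linarith [le_max_left α (C / α)]
    have hCs : C / α ≤ (t : ℝ) + 1 := by linarith [le_max_right α (C / α)]
    rw [div_le_iff₀ hα] at hCs
    have hqs := hq (t + 1) (((le_max_left T T₁).trans ((le_max_left _ _).trans hTt)).trans
      (Nat.le_succ t))
    push_cast at hqs
    set r := q (t + 1) - (1 - α / ((t : ℝ) + 1)) with hr
    have hqr : q (t + 1) = 1 - α / ((t : ℝ) + 1) + r := by rw [hr]; ring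
    have hCle : C / ((t : ℝ) + 1) ^ 2 ≤ α / (t + 1) := by
      rw [div_le_div_iff₀ (by positivity) hs0]
      nlinarith
    have hCle' : C / ((t : ℝ) + 1) ^ 2 ≤ C / (t + 1) := by
      gcongr
      nlinarith
    have hC1 : C / ((t : ℝ) + 1) ^ 2 * t ≤ C / (t + 1) := by
      calc _ ≤ C / ((t : ℝ) + 1) ^ 2 * (t + 1) := by gcongr; linarith
        _ = _ := by field_simp
    have hα1 : α / ((t : ℝ) + 1) ≤ 1 := (div_le_one hs0).2 hαs
    have hα0 : 0 < α / ((t : ℝ) + 1) := by positivity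
    have hrabs := abs_le.1 hqs
    refine ⟨?_, ?_, ?_⟩
    · rw [hqr, abs_le]
      constructor <;> linarith [hrabs.1, hrabs.2]
    · rw [hqr, abs_le, add_div]
      constructor <;> linarith [hrabs.1, hrabs.2]
    · have h1 : (1 - q (t + 1)) * t - α = -(α / (t + 1)) - r * t := by
        rw [hqr]
        field_simp
        ring
      have h2 : |r * t| ≤ C / (t + 1) := by
        rw [abs_mul, Nat.abs_cast]
        exact (mul_le_mul_of_nonneg_right hqs (Nat.cast_nonneg t)).trans hC1
      have h3 := abs_le.1 h2
      have h4 : (α + 2 * C) / ((t : ℝ) + 1) = α / (t + 1) + C / (t + 1) + C / (t + 1) := by ring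
      have h5 : 0 ≤ C / ((t : ℝ) + 1) := by positivity
      rw [h1, h4, abs_le]
      constructor <;> linarith [h3.1, h3.2]
  -- A priori linear growth: `|q| ≤ 1`, and each step forces by at most `M`.
  have hcrude : ∀ k : ℕ, |b (τ + k) - p * (τ + k)| ≤ K + M * k := by
    intro k
    induction k with
    | zero => simpa using hbτ
    | succ k ih =>
      obtain ⟨h1, h2, h3⟩ := hw (τ + k) (Nat.le_add_right _ _)
      have hstep := hb (τ + k) (Nat.le_add_right _ _)
      push_cast at h2 h3 ⊢
      have hs1 : (1 : ℝ) ≤ (τ : ℝ) + k + 1 := by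
        linarith [(Nat.cast_nonneg k : (0 : ℝ) ≤ k)]
      have h3' : |(1 - q (τ + k + 1)) * ((τ : ℝ) + k)| ≤ 2 * (α + C) := by
        have := abs_add_le ((1 - q (τ + k + 1)) * ((τ : ℝ) + k) - α) α
        rw [sub_add_cancel, abs_of_pos hα] at this
        have h4 : (α + 2 * C) / ((τ : ℝ) + k + 1) ≤ α + 2 * C := div_le_self (by positivity) hs1
        linarith
      have hsplit : b (τ + (k + 1)) - p * (τ + (k + 1))
          = q (τ + k + 1) * (b (τ + k) - p * (τ + k))
            + (1 - p - p * ((1 - q (τ + k + 1)) * ((τ : ℝ) + k))) := by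
        rw [← add_assoc, hstep]
        ring
      have hres : |1 - p - p * ((1 - q (τ + k + 1)) * ((τ : ℝ) + k))| ≤ M := by
        have a1 := abs_sub (1 - p) (p * ((1 - q (τ + k + 1)) * ((τ : ℝ) + k)))
        have a2 := abs_sub 1 p
        rw [abs_one] at a2
        rw [abs_mul p] at a1
        have a3 := mul_le_mul_of_nonneg_left h3' (abs_nonneg p)
        rw [hM]
        linarith
      rw [hsplit]
      calc _ ≤ |q (τ + k + 1)| * |b (τ + k) - p * (τ + k)|
            + |1 - p - p * ((1 - q (τ + k + 1)) * ((τ : ℝ) + k))| := by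
            rw [← abs_mul]
            exact abs_add_le _ _
        _ ≤ 1 * (K + M * k) + M :=
            add_le_add (mul_le_mul h1 ih (abs_nonneg _) zero_le_one) hres
        _ = _ := by ring
  intro k
  -- With the crude bound inserted, step `j` misses the drift by at most `C' (1 + j) / τ`.
  have hsum : |b (τ + k) - p * (τ + k) - (1 - p * α - p) * k|
      ≤ K + ∑ j ∈ Finset.range k, C' * ((1 + j) / τ) := by
    induction k with
    | zero => simpa using hbτ
    | succ k ih =>
      obtain ⟨-, h2, h3⟩ := hw (τ + k) (Nat.le_add_right _ _)
      have hstep := hb (τ + k) (Nat.le_add_right _ _)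
      have hc := hcrude k
      push_cast at h2 h3 ⊢
      have hk0 : (0 : ℝ) ≤ k := Nat.cast_nonneg k
      have hsplit : b (τ + (k + 1)) - p * (τ + (k + 1)) - (1 - p * α - p) * (k + 1)
          = (b (τ + k) - p * (τ + k) - (1 - p * α - p) * k)
            + -((1 - q (τ + k + 1)) * (b (τ + k) - p * (τ + k))
              + p * ((1 - q (τ + k + 1)) * ((τ : ℝ) + k) - α)) := by
        rw [← add_assoc, hstep]
        ring
      have hres : |-((1 - q (τ + k + 1)) * (b (τ + k) - p * (τ + k))
              + p * ((1 - q (τ + k + 1)) * ((τ : ℝ) + k) - α))| ≤ C' * ((1 + k) / τ) := by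
        rw [abs_neg]
        calc _ ≤ |1 - q (τ + k + 1)| * |b (τ + k) - p * (τ + k)|
              + |p| * |(1 - q (τ + k + 1)) * ((τ : ℝ) + k) - α| := by
              rw [← abs_mul, ← abs_mul]
              exact abs_add_le _ _
          _ ≤ (α + C) / (τ + k + 1) * (K + M * k) + |p| * ((α + 2 * C) / (τ + k + 1)) := by
              gcongr
          _ ≤ (α + C) / τ * ((K + M) * (1 + k)) + |p| * ((α + 2 * C) / τ * (1 + k)) := by
              have hle : (τ : ℝ) ≤ τ + k + 1 := by linarith
              have hKM : K + M * k ≤ (K + M) * (1 + k) := by nlinarith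
              have h5 : (α + 2 * C) / (τ + k + 1) ≤ (α + 2 * C) / τ * (1 + k) := by
                have : (α + 2 * C) / ((τ : ℝ) + k + 1) ≤ (α + 2 * C) / τ := by gcongr
                have h0 : 0 ≤ (α + 2 * C) / (τ : ℝ) := by positivity
                nlinarith
              gcongr
          _ = _ := by
              rw [hC']
              ring
      rw [hsplit, Finset.sum_range_succ, ← add_assoc]
      exact (abs_add_le _ _).trans (add_le_add ih hres)
  refine hsum.trans ?_
  rw [← Finset.mul_sum]
  gcongr
  calc ∑ j ∈ Finset.range k, (1 + (j : ℝ)) / τ ≤ ∑ _j ∈ Finset.range k, (1 + (k : ℝ)) / τ := by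
        refine Finset.sum_le_sum fun j hj => ?_
        have : (j : ℝ) ≤ k := by exact_mod_cast (Finset.mem_range.1 hj).le
        gcongr
    _ = _ := by
        rw [Finset.sum_const, Finset.card_range, nsmul_eq_mul]
        ring

end Recursion

/-! ### The changepoint and the asymptotics -/

theorem meanRec_succ (m : ℕ) (δ : ℕ → ℝ) {t : ℕ} (ht : 1 ≤ t) :
    meanRec m δ (t + 1)
      = Multigraph.survival m (δ (t + 1)) (t + 1) * meanRec m δ t + 1 := by
  obtain ⟨s, rfl⟩ : ∃ s, t = s + 1 := ⟨t - 1, by omega⟩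
  rfl

theorem meanRec_congr (m : ℕ) {δ δ' : ℕ → ℝ} (t : ℕ) (h : ∀ s ≤ t, δ s = δ' s) :
    meanRec m δ t = meanRec m δ' t := by
  induction t with
  | zero => rfl
  | succ t ih =>
    rcases Nat.eq_zero_or_pos t with rfl | ht
    · rfl
    · rw [meanRec_succ m δ ht, meanRec_succ m δ' ht, h _ le_rfl,
        ih fun s hs => h s (hs.trans (Nat.le_succ t))]

theorem exists_meanNumDegree_bound {m : ℕ} (hm : 1 ≤ m) {δ₀ δ₁ : ℝ} (hδ₀ : -(m : ℝ) < δ₀)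
    (hδ₁ : -(m : ℝ) < δ₁) :
    ∃ K C T, 0 ≤ C ∧ ∀ τ : ℕ, T ≤ τ → ∀ n : ℕ, τ ≤ n →
      |meanNumDegree m δ₀ δ₁ τ m n - n * pMin m δ₀
          - ((n : ℝ) - τ) * (1 - pMin m δ₀ / pMin m δ₁)|
        ≤ K + C * (((n : ℝ) - τ) * (1 + ((n : ℝ) - τ)) / τ) := by
  obtain ⟨C₀, T₀, -, hq₀⟩ := exists_survival_bound hδ₀
  obtain ⟨C₁, T₁, hC₁, hq₁⟩ := exists_survival_bound hδ₁
  have hα₁ := hitRate_pos hm hδ₁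
  -- The recursion holds only from time `1`.
  have hq₀' : ∀ t : ℕ, max T₀ 1 ≤ t →
      |Multigraph.survival m δ₀ t - (1 - hitRate m δ₀ / t)| ≤ C₀ / (t : ℝ) ^ 2 :=
    fun t ht => hq₀ t ((le_max_left _ _).trans ht)
  obtain ⟨K, T₂, hK, hbd₀⟩ := exists_forall_abs_sub_le (hitRate_pos hm hδ₀) hq₀'
    (a := meanRec m fun _ => δ₀) fun t ht => meanRec_succ m _ ((le_max_right _ _).trans ht)
  obtain ⟨C, T₃, hC, hbd₁⟩ :=
    exists_forall_abs_sub_linear_le hα₁ hC₁ hq₁ (pMin m δ₀) hK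
  refine ⟨K, C, max (max T₂ T₃) 1, hC, fun τ hτ n hn => ?_⟩
  have hτ1 : 1 ≤ τ := (le_max_right _ _).trans hτ
  obtain ⟨k, rfl⟩ := Nat.exists_eq_add_of_le hn
  have hstart : meanRec m (changepoint δ₀ δ₁ τ) τ = meanRec m (fun _ => δ₀) τ :=
    meanRec_congr m τ fun s hs => if_pos hs
  have key := hbd₁ τ ((le_max_right _ _).trans ((le_max_left _ _).trans hτ))
    (meanRec m (changepoint δ₀ δ₁ τ)) (fun t ht => by
      rw [meanRec_succ m _ (hτ1.trans ht), changepoint, if_neg (by omega)])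
    (by
      rw [hstart, pMin_eq hm hδ₀]
      exact hbd₀ τ ((le_max_left _ _).trans ((le_max_left _ _).trans hτ))) k
  rw [meanNumDegree_eq_meanRec hδ₀ hδ₁ τ (hτ1.trans hn)]
  have hp : 1 - pMin m δ₀ / pMin m δ₁ = 1 - pMin m δ₀ * hitRate m δ₁ - pMin m δ₀ := by
    rw [pMin_eq hm hδ₁, div_div_eq_mul_div, div_one]
    ring
  push_cast
  rw [hp, add_sub_cancel_left, mul_comm _ (pMin m δ₀), mul_comm (k : ℝ) (1 - _ - _)]
  exact key

theorem one_sub_pMin_div_pMin {m : ℕ} (hm : 1 ≤ m) {δ₀ δ₁ : ℝ} (hδ₀ : -(m : ℝ) < δ₀)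
    (hδ₁ : -(m : ℝ) < δ₁) :
    1 - pMin m δ₀ / pMin m δ₁
      = (δ₀ - δ₁) * (1 / ((2 + δ₁ / m) * (m + δ₀ + 2 + δ₀ / m))) := by
  have hm' : (0 : ℝ) < m := by exact_mod_cast hm
  have hpos : ∀ {d : ℝ}, -(m : ℝ) < d → 0 < 2 + d / m ∧ 0 < m + d + 2 + d / m := by
    intro d hd
    have h1 : -1 < d / m := by
      rw [lt_div_iff₀ hm']
      linarith
    constructor <;> linarith
  obtain ⟨h0, h0'⟩ := hpos hδ₀
  obtain ⟨h1, h1'⟩ := hpos hδ₁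
  have e0 : (m : ℝ) * (δ₀ / m) = δ₀ := by field_simp
  have e1 : (m : ℝ) * (δ₁ / m) = δ₁ := by field_simp
  rw [pMin, pMin]
  -- With `δ₀ = m x`, `δ₁ = m y` the numerator collapses to `m (x - y)`.
  set x := δ₀ / (m : ℝ)
  set y := δ₁ / (m : ℝ)
  rw [← e0] at h0' ⊢
  rw [← e1] at h1' ⊢
  rw [div_div_div_eq, mul_one_div, one_sub_div (mul_pos h0' h1).ne',
    div_eq_div_iff (mul_pos h0' h1).ne' (mul_pos h1 h0').ne']
  ring

theorem isEquivalent_of_changepoint_bound {u : ℕ → ℝ} {κ c γ K C : ℝ} {τ : ℕ → ℕ} {T : ℕ}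
    (hκ : κ ≠ 0) (hc : 0 < c) (hγ₀ : 0 < γ) (hγ₁ : γ < 1) (hC : 0 ≤ C)
    (hτ : ∀ᶠ n : ℕ in atTop, |(τ n : ℝ) - ((n : ℝ) - c * (n : ℝ) ^ γ)| < 1)
    (hu : ∀ n, T ≤ τ n → τ n ≤ n → |u n - ((n : ℝ) - τ n) * κ|
      ≤ K + C * (((n : ℝ) - τ n) * (1 + ((n : ℝ) - τ n)) / τ n)) :
    IsEquivalent atTop u (fun n : ℕ => c * (n : ℝ) ^ γ * κ) := by
  have hg : Tendsto (fun n : ℕ => (n : ℝ) ^ γ) atTop atTop :=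
    (tendsto_rpow_atTop hγ₀).comp tendsto_natCast_atTop_atTop
  have hgn : Tendsto (fun n : ℕ => (n : ℝ) ^ γ / n) atTop (nhds 0) := by
    have h1 : Tendsto (fun n : ℕ => (n : ℝ) ^ (-(1 - γ))) atTop (nhds 0) :=
      (tendsto_rpow_neg_atTop (by linarith)).comp tendsto_natCast_atTop_atTop
    refine h1.congr' ?_
    filter_upwards [eventually_gt_atTop 0] with n hn
    have hn' : (0 : ℝ) < n := by exact_mod_cast hn
    rw [neg_sub, Real.rpow_sub_one hn'.ne']
  have hconst : ∀ a : ℝ, (fun _ : ℕ => a) =o[atTop] (fun n : ℕ => (n : ℝ) ^ γ) := fun a =>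
    isLittleO_const_left.2 (Or.inr (tendsto_norm_atTop_atTop.comp hg))
  have hsmall : Tendsto (fun n : ℕ => (c * (n : ℝ) ^ γ + 2) / n) atTop (nhds 0) := by
    have := (hgn.const_mul c).add (tendsto_const_div_atTop_nhds_zero_nat (2 : ℝ))
    simp only [mul_zero, add_zero] at this
    refine this.congr fun n => ?_
    ring
  have hbig : (fun n : ℕ => c * (n : ℝ) ^ γ + 1) =O[atTop] (fun n : ℕ => (n : ℝ) ^ γ) :=
    (isBigO_const_mul_self c _ _).add (hconst 1).isBigO
  have hmaj : (fun n : ℕ => (|κ| + K)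
      + 2 * C * ((c * (n : ℝ) ^ γ + 1) * ((c * (n : ℝ) ^ γ + 2) / n)))
      =o[atTop] (fun n : ℕ => (n : ℝ) ^ γ) := by
    refine (hconst _).add (IsLittleO.const_mul_left ?_ _)
    have := hbig.mul_isLittleO ((isLittleO_one_iff ℝ).2 hsmall)
    simpa only [mul_one] using this
  have hmain : (fun n => u n - c * (n : ℝ) ^ γ * κ) =o[atTop] (fun n : ℕ => (n : ℝ) ^ γ) := by
    refine IsBigO.trans_isLittleO (IsBigO.of_bound 1 ?_) hmaj
    -- These give, in turn, `τ n ≥ n / 2`, `τ n ≤ n` and `τ n ≥ T`.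
    filter_upwards [hτ, hsmall.eventually (ge_mem_nhds (by norm_num : (0 : ℝ) < 1 / 2)),
      hg.eventually (eventually_ge_atTop (1 / c)), eventually_ge_atTop (2 * T + 1)]
      with n h1 h2 h3 h4
    have hn : (2 * T + 1 : ℝ) ≤ n := by exact_mod_cast h4
    have hn0 : (0 : ℝ) < n := by linarith [(Nat.cast_nonneg T : (0 : ℝ) ≤ T)]
    rw [div_le_iff₀ hn0] at h2
    rw [div_le_iff₀ hc] at h3
    set g := (n : ℝ) ^ γ
    obtain ⟨h1a, h1b⟩ := abs_lt.1 h1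
    have hτhalf : (n : ℝ) / 2 ≤ τ n := by linarith
    have hτT : T ≤ τ n := by
      have : (T : ℝ) ≤ τ n := by linarith
      exact_mod_cast this
    have hτn' : (τ n : ℝ) ≤ n := by linarith
    have hτn : τ n ≤ n := by exact_mod_cast hτn'
    have hb := hu n hτT hτn
    have hk : (n : ℝ) - τ n ≤ c * g + 1 := by linarith
    have hk0 : 0 ≤ (n : ℝ) - τ n := by linarith
    have hquot : ((n : ℝ) - τ n) * (1 + ((n : ℝ) - τ n)) / τ n
        ≤ (c * g + 1) * (c * g + 2) / (n / 2) := by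
      refine div_le_div₀ (mul_nonneg (by linarith) (by linarith)) ?_ (by linarith) hτhalf
      exact mul_le_mul hk (by linarith) (by linarith) (by linarith)
    have hlin : |((n : ℝ) - τ n) * κ - c * g * κ| ≤ |κ| := by
      rw [← sub_mul, abs_mul]
      have : |(n : ℝ) - τ n - c * g| ≤ 1 := by
        rw [abs_le]
        constructor <;> linarith
      nlinarith [abs_nonneg κ]
    rw [one_mul, Real.norm_eq_abs, Real.norm_eq_abs]
    refine le_trans ?_ (le_abs_self _)
    calc |u n - c * g * κ| ≤ |u n - ((n : ℝ) - τ n) * κ| + |((n : ℝ) - τ n) * κ - c * g * κ| :=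
          abs_sub_le _ _ _
      _ ≤ K + C * ((c * g + 1) * (c * g + 2) / (n / 2)) + |κ| :=
          add_le_add (hb.trans (by gcongr)) hlin
      _ = _ := by
          field_simp
          ring
  -- Only here is `κ ≠ 0` needed: `n^γ` must be comparable to the limit term.
  have hfin := hmain.trans_isBigO (isBigO_self_const_mul (mul_ne_zero hc.ne' hκ) _ _)
  refine hfin.congr_right fun n => ?_
  ring

end PrefAttach

theorem proposition7p1 (m : ℕ) (hm : 1 ≤ m) (δ₀ δ₁ : ℝ) (hδ₀ : -(m : ℝ) < δ₀)
    (hδ₁ : -(m : ℝ) < δ₁) (hne : δ₀ ≠ δ₁) (c γ : ℝ) (hc : 0 < c) (hγ₀ : 0 < γ) (hγ₁ : γ < 1)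
    (τ : ℕ → ℕ)
    (hτ : ∀ᶠ n : ℕ in atTop, |(τ n : ℝ) - ((n : ℝ) - c * (n : ℝ) ^ γ)| < 1) :
    IsEquivalent atTop
      (fun n : ℕ => PrefAttach.meanNumDegree m δ₀ δ₁ (τ n) m n - n * PrefAttach.pMin m δ₀)
      (fun n : ℕ => c * (n : ℝ) ^ γ * (1 - PrefAttach.pMin m δ₀ / PrefAttach.pMin m δ₁)) ∧
    IsEquivalent atTop
      (fun n : ℕ => PrefAttach.meanNumDegree m δ₀ δ₁ (τ n) m n - n * PrefAttach.pMin m δ₀)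
      (fun n : ℕ => c * (n : ℝ) ^ γ * (δ₀ - δ₁) *
        (1 / ((2 + δ₁ / m) * (m + δ₀ + 2 + δ₀ / m)))) := by
  have hform := PrefAttach.one_sub_pMin_div_pMin hm hδ₀ hδ₁
  have hκ : 1 - PrefAttach.pMin m δ₀ / PrefAttach.pMin m δ₁ ≠ 0 := by
    have hm' : (0 : ℝ) < m := by exact_mod_cast hm
    have hpos : ∀ {d : ℝ}, -(m : ℝ) < d → -1 < d / m := by
      intro d hd
      rw [lt_div_iff₀ hm']
      linarith
    have h0 := hpos hδ₀
    have h1 := hpos hδ₁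
    rw [hform]
    exact mul_ne_zero (sub_ne_zero.2 hne)
      (one_div_ne_zero (mul_ne_zero (by linarith) (by linarith)))
  obtain ⟨K, C, T, hC, hbound⟩ := PrefAttach.exists_meanNumDegree_bound hm hδ₀ hδ₁
  have hfirst := PrefAttach.isEquivalent_of_changepoint_bound hκ hc hγ₀ hγ₁ hC hτ
    (fun n hT hn => hbound (τ n) hT n hn)
  refine ⟨hfirst, ?_⟩
  rw [hform] at hfirst
  simpa only [mul_assoc] using hfirst
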